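/- Let $\mathcal S=\mathcal S(\mathbb R)$ be the real Schwartz space with its Fréchet topology and let $\mathcal S'$ be its dual, the space of real tempered distributions, with the weak-* topology and its Borel $\sigma$-algebra. Let $\mathcal N:\mathcal S\to\mathbb R$ be a continuous function such that * $\mathcal N$ is conditionally negative definite: $\sum_{j,k=1}^n c_j\overline{c_k}\,\mathcal N(s_j-s_k)\le 0$ for all $n\in\mathbb N$, $s_1,\dots,s_n\in\mathcal S$ and $c_1,\dots,c_n\in\mathbb C$ with $\sum_{j=1}^n c_j=0$; * $\mathcal N(\alpha s)=\alpha^2\mathcal N(s)$ for all $\alpha\in\mathbb R$ and $s\in\mathcal S$; * the reproducing kernel Hilbert space of the kernel $\varphi_{\mathcal N}(s,t)=\tfrac12\big(\mathcal N(s)+\mathcal N(t)-\mathcal N(s-t)\big)$ on $\mathcal S\times\mathcal S$ is infinite-dimensional; equivalently, the linear span of the functions $\varphi_{\mathcal N}(s,\cdot)$, $s\in\mathcal S$, is infinite-dimensional. For $\lambda>0$ let $\mathbb P_\lambda$ be the (unique, by the Bochner–Minlos theorem) probability measure on $\mathcal S'$ with $$\int_{\mathcal S'}e^{i\langle\omega,s\rangle}\,d\mathbb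 P_\lambda(\omega)=e^{-\lambda^2\mathcal N(s)/2}\qquad\text{for all }s\in\mathcal S.$$ Then $\mathbb P_{\lambda_1}$ and $\mathbb P_{\lambda_2}$ are mutually singular for all $\lambda_1,\lambda_2>0$ with $\lambda_1\ne\lambda_2$. -/

import Mathlib

open MeasureTheory
open scoped SchwartzMap ComplexOrder ComplexConjugate

/-- A real kernel `φ` is conditionally negative definite if `∑ⱼ ∑ₖ cⱼ c̄ₖ φ(xⱼ, xₖ) ≤ 0` for all
finite families of points and all complex coefficients of sum zero.  The inequality is the one of
`ℂ`: the left-hand side is a real number and is nonpositive. -/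
def IsCNDKernel {X : Type*} (φ : X → X → ℝ) : Prop :=
  ∀ (n : ℕ) (x : Fin n → X) (c : Fin n → ℂ), ∑ j, c j = 0 →
    ∑ j, ∑ k, c j * conj (c k) * ((φ (x j) (x k) : ℝ) : ℂ) ≤ 0

/-- A real function `f` is conditionally negative definite if the kernel `f (x - y)` is. -/
def IsCNDFunction {X : Type*} [AddGroup X] (f : X → ℝ) : Prop :=
  IsCNDKernel fun x y : X => f (x - y)

/-- The space `S'` of real tempered distributions on `ℝ`: continuous linear functionals on the
real Schwartz space (with its Fréchet topology), equipped with the weak-* topology. -/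
abbrev RealTemperedDistribution : Type := 𝓢(ℝ, ℝ) →Lₚₜ[ℝ] ℝ

/-- `S'` carries its Borel σ-algebra. -/
noncomputable instance RealTemperedDistribution.instMeasurableSpace :
    MeasurableSpace RealTemperedDistribution := borel _

instance RealTemperedDistribution.instBorelSpace : BorelSpace RealTemperedDistribution := ⟨rfl⟩

/-- The kernel `φ_N(s, t) = (N(s) + N(t) - N(s - t)) / 2` attached to `N : S → ℝ`. -/
noncomputable def associatedKernel (N : 𝓢(ℝ, ℝ) → ℝ) (s t : 𝓢(ℝ, ℝ)) : ℝ :=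
  (N s + N t - N (s - t)) / 2

/-- The space `H₀` of functions on `S` spanned by the functions `φ_s = φ_N(s, ·)`.  The reproducing
kernel Hilbert space of `φ_N` is the completion of `H₀`, so that it is infinite-dimensional if and
only if `H₀` is. -/
def preRKHS (N : 𝓢(ℝ, ℝ) → ℝ) : Submodule ℝ (𝓢(ℝ, ℝ) → ℝ) :=
  Submodule.span ℝ (Set.range (associatedKernel N))

/-- `P` is the probability measure on `S'` whose characteristic functional is
`s ↦ exp (-l² N(s) / 2)`. -/
structure IsBochnerMinlosMeasure (N : 𝓢(ℝ, ℝ) → ℝ) (l : ℝ)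
    (P : Measure RealTemperedDistribution) : Prop where
  isProbabilityMeasure : IsProbabilityMeasure P
  integral_exp : ∀ s : 𝓢(ℝ, ℝ),
    ∫ ω : RealTemperedDistribution, Complex.exp (Complex.I * ((ω s : ℝ) : ℂ)) ∂P
      = ((Real.exp (-(l ^ 2 * N s) / 2) : ℝ) : ℂ)

open ProbabilityTheory Filter Topology
open scoped NNReal

/-! Evaluations at test functions are centred Gaussians with covariance `l ^ 2` times the kernel of
`N`. Infinite dimension yields infinitely many test functions orthogonal for `N`, with equal `N`.
Orthogonality does not involve `l`, so their evaluations are pairwise independent under both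
measures. By the strong law their squares average to `l ^ 2 * v`, so the two measures live on
disjoint sets of `ω`. -/

namespace RealTemperedDistribution

/-- Evaluation at a fixed test function is weak-* continuous, hence Borel measurable. -/
lemma measurable_eval (s : 𝓢(ℝ, ℝ)) :
    Measurable fun ω : RealTemperedDistribution => ω s :=
  (PointwiseConvergenceCLM.evalCLM (RingHom.id ℝ) ℝ s).continuous.measurable

end RealTemperedDistribution

open RealTemperedDistribution

namespace IsBochnerMinlosMeasure

variable {N : 𝓢(ℝ, ℝ) → ℝ} {l : ℝ} {P : Measure RealTemperedDistribution}

lemma charFun_map_eval (hP : IsBochnerMinlosMeasure N l P) (s : 𝓢(ℝ, ℝ)) (t : ℝ) :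
    charFun (P.map fun ω => ω s) t = ((Real.exp (-(l ^ 2 * N (t • s)) / 2) : ℝ) : ℂ) := by
  rw [← hP.integral_exp, charFun_apply_real,
    integral_map (measurable_eval s).aemeasurable (by fun_prop)]
  refine integral_congr_ae (.of_forall fun ω => ?_)
  simp only [map_smul, smul_eq_mul, Complex.ofReal_mul]
  rw [mul_comm]

/-- A characteristic function is bounded by 1 in modulus. -/
lemma variance_nonneg (hP : IsBochnerMinlosMeasure N l P) (s : 𝓢(ℝ, ℝ)) : 0 ≤ l ^ 2 * N s := by
  have := hP.isProbabilityMeasure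
  have : IsProbabilityMeasure (P.map fun ω => ω s) :=
    Measure.isProbabilityMeasure_map (measurable_eval s).aemeasurable
  have h := norm_charFun_le_one (μ := P.map fun ω => ω s) 1
  rw [hP.charFun_map_eval, one_smul, Complex.norm_real, Real.norm_eq_abs, Real.abs_exp,
    Real.exp_le_one_iff] at h
  linarith

/-- Under the Bochner–Minlos measure, `ω ↦ ω s` is a centred Gaussian of variance `l² N(s)`. -/
lemma map_eval (hP : IsBochnerMinlosMeasure N l P)
    (hscale : ∀ (a : ℝ) (s : 𝓢(ℝ, ℝ)), N (a • s) = a ^ 2 * N s) (s : 𝓢(ℝ, ℝ)) :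
    P.map (fun ω => ω s) = gaussianReal 0 (l ^ 2 * N s).toNNReal := by
  have := hP.isProbabilityMeasure
  refine Measure.ext_of_charFun (funext fun t => ?_)
  rw [hP.charFun_map_eval, charFun_gaussianReal, hscale, Complex.ofReal_exp]
  have h : (((l ^ 2 * N s).toNNReal : ℝ) : ℂ) = ((l ^ 2 * N s : ℝ) : ℂ) := by
    rw [Real.coe_toNNReal _ (hP.variance_nonneg s)]
  rw [h]
  push_cast
  congr 1
  ring

lemma memLp_eval (hP : IsBochnerMinlosMeasure N l P)
    (hscale : ∀ (a : ℝ) (s : 𝓢(ℝ, ℝ)), N (a • s) = a ^ 2 * N s) (s : 𝓢(ℝ, ℝ)) :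
    MemLp (fun ω : RealTemperedDistribution => ω s) 2 P := by
  have h := memLp_id_gaussianReal' (μ := 0) (v := (l ^ 2 * N s).toNNReal) 2 (by simp)
  rw [← hP.map_eval hscale s] at h
  exact h.comp_of_map (measurable_eval s).aemeasurable

lemma integral_eval_sq (hP : IsBochnerMinlosMeasure N l P)
    (hscale : ∀ (a : ℝ) (s : 𝓢(ℝ, ℝ)), N (a • s) = a ^ 2 * N s) (s : 𝓢(ℝ, ℝ)) :
    ∫ ω : RealTemperedDistribution, ω s ^ 2 ∂P = l ^ 2 * N s := by
  have h := variance_of_integral_eq_zero (X := id) (μ := gaussianReal 0 (l ^ 2 * N s).toNNReal)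
    aemeasurable_id (by simp)
  rw [variance_id_gaussianReal, Real.coe_toNNReal _ (hP.variance_nonneg s),
    ← hP.map_eval hscale s,
    integral_map (measurable_eval s).aemeasurable (by fun_prop)] at h
  exact h.symm

/-- Evaluations at two test functions that are orthogonal for `N` are independent. -/
lemma indepFun_eval (hP : IsBochnerMinlosMeasure N l P) {s t : 𝓢(ℝ, ℝ)}
    (hst : ∀ a b : ℝ, N (a • s + b • t) = N (a • s) + N (b • t)) :
    IndepFun (fun ω : RealTemperedDistribution => ω s) (fun ω => ω t) P := by
  have := hP.isProbabilityMeasure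
  have hs := measurable_eval s
  have ht := measurable_eval t
  rw [indepFun_iff_charFun_prod hs.aemeasurable ht.aemeasurable]
  intro x
  rw [hP.charFun_map_eval, hP.charFun_map_eval, ← Complex.ofReal_mul, ← Real.exp_add,
    ← add_div, ← neg_add, ← mul_add, ← hst, ← hP.integral_exp, charFun_apply,
    integral_map (by fun_prop) (by fun_prop)]
  refine integral_congr_ae (.of_forall fun ω => ?_)
  simp only [map_add, map_smul, smul_eq_mul, WithLp.prod_inner_apply, RCLike.inner_apply,
    conj_trivial]
  rw [mul_comm]

/-- The law of large numbers for squared evaluations along a sequence orthogonal for `N`. -/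
lemma tendsto_average_sq (hP : IsBochnerMinlosMeasure N l P)
    (hscale : ∀ (a : ℝ) (s : 𝓢(ℝ, ℝ)), N (a • s) = a ^ 2 * N s) {v : ℝ} {s : ℕ → 𝓢(ℝ, ℝ)}
    (hv : ∀ i, N (s i) = v)
    (hs : ∀ i j, i ≠ j → ∀ a b : ℝ, N (a • s i + b • s j) = N (a • s i) + N (b • s j)) :
    ∀ᵐ ω ∂P, Tendsto (fun n : ℕ => (∑ i ∈ Finset.range n, ω (s i) ^ 2) / (n : ℝ)) atTop
      (𝓝 (l ^ 2 * v)) := by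
  -- Pairwise independence suffices for this strong law.
  have h := strong_law_ae_real (μ := P)
    (fun i (ω : RealTemperedDistribution) => ω (s i) ^ 2)
    (hP.memLp_eval hscale (s 0)).integrable_sq
    (fun i j hij => (hP.indepFun_eval (hs i j hij)).comp
      (φ := fun x : ℝ => x ^ 2) (ψ := fun x : ℝ => x ^ 2) (by fun_prop) (by fun_prop))
    (fun i => by
      have hid : IdentDistrib (fun ω : RealTemperedDistribution => ω (s i)) (fun ω => ω (s 0))
          P P :=
        ⟨(measurable_eval _).aemeasurable, (measurable_eval _).aemeasurable, by
          rw [hP.map_eval hscale, hP.map_eval hscale, hv, hv]⟩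
      exact hid.comp (u := fun x : ℝ => x ^ 2) (by fun_prop))
  rwa [hP.integral_eval_sq hscale, hv] at h

/-- The linear map sending a test function to its evaluation, as an element of `L²(P)`. -/
noncomputable def evalLp (hP : IsBochnerMinlosMeasure N l P)
    (hscale : ∀ (a : ℝ) (s : 𝓢(ℝ, ℝ)), N (a • s) = a ^ 2 * N s) :
    𝓢(ℝ, ℝ) →ₗ[ℝ] Lp ℝ 2 P where
  toFun s := (hP.memLp_eval hscale s).toLp _
  map_add' s t := by
    rw [← MemLp.toLp_add]
    exact MemLp.toLp_congr _ _ (.of_forall fun ω => map_add ω s t)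
  map_smul' a s := by
    rw [RingHom.id_apply, ← MemLp.toLp_const_smul]
    exact MemLp.toLp_congr _ _ (.of_forall fun ω => map_smul ω a s)

variable (hP : IsBochnerMinlosMeasure N l P)
  (hscale : ∀ (a : ℝ) (s : 𝓢(ℝ, ℝ)), N (a • s) = a ^ 2 * N s)

lemma inner_evalLp_self (s : 𝓢(ℝ, ℝ)) :
    inner ℝ (hP.evalLp hscale s) (hP.evalLp hscale s) = l ^ 2 * N s := by
  rw [← hP.integral_eval_sq hscale s, L2.inner_def]
  refine integral_congr_ae ?_
  filter_upwards [(hP.memLp_eval hscale s).coeFn_toLp] with ω hω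
  change inner ℝ ((hP.memLp_eval hscale s).toLp _ ω) ((hP.memLp_eval hscale s).toLp _ ω) = _
  rw [hω, real_inner_self_eq_norm_sq, Real.norm_eq_abs, sq_abs]

/-- Polarization of `inner_evalLp_self`. -/
lemma inner_evalLp (s t : 𝓢(ℝ, ℝ)) :
    inner ℝ (hP.evalLp hscale s) (hP.evalLp hscale t) = l ^ 2 * associatedKernel N s t := by
  have h := hP.inner_evalLp_self hscale (s - t)
  rw [map_sub, real_inner_sub_sub_self, inner_evalLp_self, inner_evalLp_self] at h
  rw [associatedKernel]
  linarith

include hP hscale in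
/-- If `preRKHS N` is infinite-dimensional, there is an infinite orthonormal sequence
of evaluations in `L²(P)`. -/
lemma exists_orthonormal_evalLp (hl : l ≠ 0) (hinf : ¬ FiniteDimensional ℝ (preRKHS N)) :
    ∃ s : ℕ → 𝓢(ℝ, ℝ), Orthonormal ℝ fun i => hP.evalLp hscale (s i) := by
  let T := hP.evalLp hscale
  have hT : ¬ FiniteDimensional ℝ (LinearMap.range T) := by
    intro hfin
    -- `R` sends `T s` to the kernel function of `s`, so a finite-dimensional range would bound
    -- `preRKHS N`.
    let R : Lp ℝ 2 P →ₗ[ℝ] (𝓢(ℝ, ℝ) → ℝ) :=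
      LinearMap.pi fun t => (l ^ 2)⁻¹ • (innerₗ (Lp ℝ 2 P)).flip (T t)
    have hle : preRKHS N ≤ (LinearMap.range T).map R := by
      refine Submodule.span_le.2 ?_
      rintro _ ⟨s, rfl⟩
      refine ⟨T s, ⟨s, rfl⟩, funext fun t => ?_⟩
      change (l ^ 2)⁻¹ * inner ℝ (T s) (T t) = _
      rw [hP.inner_evalLp hscale, inv_mul_cancel_left₀ (pow_ne_zero 2 hl)]
    exact hinf (Submodule.finiteDimensional_of_le hle)
  let b := Module.Basis.ofVectorSpace ℝ (LinearMap.range T)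
  have hb : Infinite (Module.Basis.ofVectorSpaceIndex ℝ (LinearMap.range T)) :=
    not_finite_iff_infinite.1 fun h => hT b.finiteDimensional_of_finite
  -- Gram–Schmidt runs inside the range of `T`, so that its vectors lift to test functions.
  have he := InnerProductSpace.gramSchmidtNormed_orthonormal
    (b.linearIndependent.comp _ (Infinite.natEmbedding _).injective)
  choose s hs using fun i => (InnerProductSpace.gramSchmidtNormed ℝ
    (b ∘ Infinite.natEmbedding _) i).2
  refine ⟨s, ?_⟩
  have h := he.comp_linearIsometry (LinearMap.range T).subtypeₗᵢ
  convert h using 1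
  exact funext hs

end IsBochnerMinlosMeasure

/-- Negative definiteness and continuity of `N` serve only to produce the Bochner–Minlos measures;
once these are given, the Gaussian law of the evaluations determines everything. -/
theorem theorem3p6 (N : 𝓢(ℝ, ℝ) → ℝ)
    (hcnd : IsCNDFunction N)
    (hcont : Continuous N)
    (hscale : ∀ (a : ℝ) (s : 𝓢(ℝ, ℝ)), N (a • s) = a ^ 2 * N s)
    (hinf : ¬ FiniteDimensional ℝ (preRKHS N))
    (l₁ l₂ : ℝ) (hl₁ : 0 < l₁) (hl₂ : 0 < l₂) (hne : l₁ ≠ l₂)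
    (P₁ P₂ : Measure RealTemperedDistribution)
    (hP₁ : IsBochnerMinlosMeasure N l₁ P₁) (hP₂ : IsBochnerMinlosMeasure N l₂ P₂) :
    P₁ ⟂ₘ P₂ := by
  obtain ⟨s, hs⟩ := hP₁.exists_orthonormal_evalLp hscale hl₁.ne' hinf
  have hl : l₁ ^ 2 ≠ 0 := by positivity
  have hv (i) : N (s i) = (l₁ ^ 2)⁻¹ := by
    have h := hP₁.inner_evalLp_self hscale (s i)
    rw [real_inner_self_eq_norm_sq, hs.1 i, one_pow] at h
    exact eq_inv_of_mul_eq_one_right h.symm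
  -- Orthogonality in `L²(P₁)` becomes a property of `N` alone, hence usable under `P₂`.
  have horth (i j) (hij : i ≠ j) (a b : ℝ) :
      N (a • s i + b • s j) = N (a • s i) + N (b • s j) := by
    refine mul_left_cancel₀ hl ?_
    rw [mul_add, ← hP₁.inner_evalLp_self hscale, ← hP₁.inner_evalLp_self hscale,
      ← hP₁.inner_evalLp_self hscale, map_add, real_inner_add_add_self, map_smul, map_smul,
      real_inner_smul_left (hP₁.evalLp hscale (s i)) (b • hP₁.evalLp hscale (s j)),
      real_inner_smul_right (hP₁.evalLp hscale (s i)) (hP₁.evalLp hscale (s j)), hs.2 hij]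
    ring
  -- The null sets are where the averages fail to tend to `1`, respectively `l₂ ^ 2 / l₁ ^ 2`; they
  -- cover the space because limits are unique.
  refine Measure.MutuallySingular.mk (ae_iff.1 (hP₁.tendsto_average_sq hscale hv horth))
    (ae_iff.1 (hP₂.tendsto_average_sq hscale hv horth)) fun ω _ => ?_
  rw [Set.mem_union, Set.mem_ofPred_eq, Set.mem_ofPred_eq, ← not_and_or]
  rintro ⟨h₁, h₂⟩
  exact hne ((sq_eq_sq₀ hl₁.le hl₂.le).1
    (mul_right_cancel₀ (inv_ne_zero hl) (tendsto_nhds_unique h₁ h₂)))
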